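/- For an even integer $n\ge 4$, the Goldbach factorization graph $F_n$ is the weighted directed graph whose vertices are the primes in $[2,n-2]$, with an arc from $s$ to $t$ (possibly $s=t$) if and only if $s\mid n-t$, the weight of this arc being the largest $e\ge 1$ with $s^e\mid n-t$. An autonomous component of $F_n$ is a subgraph induced by an inclusion-minimal set among the non-empty sets $U$ of vertices such that there is no arc $(s,t)$ with $s\notin U$ and $t\in U$. An autonomous component is a Goldbach component if it is induced by $\{v_1,v_2\}$ for some vertices $v_1,v_2$ (possibly equal) with $v_1+v_2=n$; it is trivial if it is induced by a single vertex and is not a Goldbach component; and it is exceptional (an EAC) if it is neither trivial nor a Goldbach component. A twin EAC is an EAC induced by exactly two vertices. Assume the abc conjecture: for every real $\varepsilon>0$ there is a constant $K>0$ such that $c\le K\,\mathrm{rad}(abc)^{1+\varepsilon}$ for all coprime positive integers $a,b$ with $c=a+b$, where $\mathrm{rad}(m)$ is the product of the distinct primes dividing $m$. Then there are only finitely many twin exceptional autonomous components; that is, there are only finitely many pairs $(n,H)$ where $n\ge 4$ is even and $H$ is a twin EAC of $F_n$. -/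

import Mathlib

open UniqueFactorizationMonoid (radical)

/-- The abc conjecture (Masser, Oesterlé): for every `ε > 0` there is a constant `K` such that
`c ≤ K * rad (a * b * c) ^ (1 + ε)` for all coprime positive integers `a`, `b` and `c = a + b`,
where `rad` is the product of the distinct prime divisors. -/
def AbcConjecture : Prop :=
  ∀ ε : ℝ, 0 < ε → ∃ K : ℝ, 0 < K ∧ ∀ a b c : ℕ, 0 < a → 0 < b → Nat.Coprime a b → a + b = c →
    (c : ℝ) ≤ K * ((radical (a * b * c) : ℕ) : ℝ) ^ (1 + ε)

/-- Directed graphs (loops allowed) on a set of elements of `α` whose arcs carry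
natural-number weights. -/
structure WeightedDigraph (α : Type*) where
  verts : Set α
  arcs : Set (α × α)
  arcs_subset : arcs ⊆ verts ×ˢ verts
  weight : arcs → ℕ

/-- The subgraph induced by a set of vertices. -/
def WeightedDigraph.induce {α : Type*} (G : WeightedDigraph α) (U : Set α) :
    WeightedDigraph α where
  verts := G.verts ∩ U
  arcs := G.arcs ∩ U ×ˢ U
  arcs_subset := fun _ h => ⟨⟨(G.arcs_subset h.1).1, h.2.1⟩, ⟨(G.arcs_subset h.1).2, h.2.2⟩⟩
  weight := fun a => G.weight ⟨a.1, a.2.1⟩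

namespace Goldbach

/-- The vertices of `F_n`: the primes in the interval `[2, n - 2]`. -/
def gfgVerts (n : ℕ) : Set ℕ := {p | p.Prime ∧ 2 ≤ p ∧ p + 2 ≤ n}

/-- The Goldbach factorization graph `F_n`: there is an arc from `s` to `t` when `s ∣ n - t`
(here `t + 2 ≤ n`, so the subtraction is genuine and its value is positive), and its weight is
the largest `e` with `s ^ e ∣ n - t`. -/
def gfg (n : ℕ) : WeightedDigraph ℕ where
  verts := gfgVerts n
  arcs := {a | a.1 ∈ gfgVerts n ∧ a.2 ∈ gfgVerts n ∧ a.1 ∣ n - a.2}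
  arcs_subset := fun _ h => ⟨h.1, h.2.1⟩
  weight := fun a => (n - a.1.2).factorization a.1.1

/-- `U` is a non-empty set of vertices of `F_n` that no arc enters from outside. -/
def IsAutonomousSet (n : ℕ) (U : Set ℕ) : Prop :=
  U.Nonempty ∧ U ⊆ (gfg n).verts ∧ ∀ s ∈ (gfg n).verts \ U, ∀ t ∈ U, (s, t) ∉ (gfg n).arcs

/-- An autonomous component of `F_n`: a subgraph induced by an inclusion-minimal autonomous set.
(Inclusion of induced subgraphs is inclusion of their vertex sets.) -/
def IsAutonomousComponent (n : ℕ) (H : WeightedDigraph ℕ) : Prop :=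
  ∃ U : Set ℕ, Minimal (IsAutonomousSet n) U ∧ H = (gfg n).induce U

/-- A Goldbach autonomous component: induced by vertices `v₁, v₂` (possibly equal) with
`v₁ + v₂ = n`. -/
def IsGAC (n : ℕ) (H : WeightedDigraph ℕ) : Prop :=
  IsAutonomousComponent n H ∧
    ∃ v₁ ∈ (gfg n).verts, ∃ v₂ ∈ (gfg n).verts, v₁ + v₂ = n ∧ H.verts = {v₁, v₂}

/-- A trivial autonomous component: induced by a single vertex and not Goldbach. -/
def IsTAC (n : ℕ) (H : WeightedDigraph ℕ) : Prop :=
  IsAutonomousComponent n H ∧ (∃ v, H.verts = {v}) ∧ ¬ IsGAC n H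

/-- An exceptional autonomous component: neither trivial nor Goldbach. -/
def IsEAC (n : ℕ) (H : WeightedDigraph ℕ) : Prop :=
  IsAutonomousComponent n H ∧ ¬ IsTAC n H ∧ ¬ IsGAC n H

/-- A twin EAC: an exceptional autonomous component induced by exactly two vertices. -/
def IsTwinEAC (n : ℕ) (H : WeightedDigraph ℕ) : Prop :=
  IsEAC n H ∧ H.verts.ncard = 2

end Goldbach

/-!
A twin exceptional component is induced by two primes `p < q`. No arc enters `{p, q}`, so `n - p`
and `n - q` have no prime factors besides `p` and `q`; minimality gives `q ∣ n - p` and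
`p ∣ n - q`. If `p` also divided `n - p`, it would divide both `n` and `q`; hence `n - p = q ^ b`
and `n - q = p ^ c`, and `b, c ≥ 2` since the component is not a Goldbach component. It remains to
bound the solutions of `p ^ c + q = q ^ b + p` with `2 ≤ b`, where `b < c` is automatic.

The abc conjecture is used in the form `AbcConjecture.exists_bound`: if the radical of the triple
`(x, y, z)` is at most of order `z ^ (k / (k + 1))`, then `z` is bounded.

* For `b ≥ 3` it is applied to `p ^ c + (q - p) = q ^ b`, whose radical is at most `p * q ^ 2`;
  here `p ≤ z ^ (1 / 4)` and `q ≤ z ^ (1 / 3)`.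
* For `b = 2` that triple is not good enough. Completing the square gives
  `(2 * q - 1) ^ 2 + (4 * p - 1) = 4 * p ^ c`, again a coprime triple, with radical of order at most
  `p ^ 2 * q`, and this suffices when `c ≥ 5`. The cases `c = 3, 4` are excluded by hand
  (`no_solution_of_exponent_three_or_four`): `p` divides `q - 1 = p * m`, and then `p` divides
  `m + 1`, which makes `q` too large.
-/

/-! ### The abc conjecture for triples of small radical -/

/-- Under abc, triples whose radical is at most of order `z ^ (k / (k + 1))` have bounded `z`. -/
lemma AbcConjecture.exists_bound (habc : AbcConjecture) (k A : ℕ) (hk : 0 < k) :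
    ∃ B : ℕ, ∀ x y z r : ℕ, 0 < x → 0 < y → Nat.Coprime x y → x + y = z →
      radical (x * y * z) ≤ r → r ^ (k + 1) ≤ A * z ^ k → z ≤ B := by
  obtain ⟨K, hK, h⟩ := habc (1 / (2 * k)) (by positivity)
  refine ⟨⌈K ^ (2 * k * (k + 1)) * (A : ℝ) ^ (2 * k + 1)⌉₊, ?_⟩
  intro x y z r hx hy hxy hz hr hrA
  have hz1 : (1 : ℝ) ≤ z := by exact_mod_cast (by omega : 1 ≤ z)
  have hkR : (0 : ℝ) < k := by exact_mod_cast hk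
  have h1 : (z : ℝ) ≤ K * (r : ℝ) ^ (1 + 1 / (2 * k) : ℝ) := by
    refine (h x y z hx hy hxy hz).trans ?_
    gcongr
  have h2 : (z : ℝ) ^ (2 * k) ≤ K ^ (2 * k) * (r : ℝ) ^ (2 * k + 1) := by
    calc (z : ℝ) ^ (2 * k) ≤ (K * (r : ℝ) ^ (1 + 1 / (2 * k) : ℝ)) ^ (2 * k) := by gcongr
      _ = K ^ (2 * k) * (r : ℝ) ^ (2 * k + 1) := by
        rw [mul_pow, ← Real.rpow_natCast ((r : ℝ) ^ _), ← Real.rpow_mul (by positivity),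
          ← Real.rpow_natCast (r : ℝ) (2 * k + 1)]
        congr 2
        push_cast
        field_simp
  have h3 : (r : ℝ) ^ (k + 1) ≤ A * (z : ℝ) ^ k := by exact_mod_cast hrA
  have h4 : (z : ℝ) ^ (k * (2 * k + 1)) * (z : ℝ) ^ k ≤
      (z : ℝ) ^ (k * (2 * k + 1)) * (K ^ (2 * k * (k + 1)) * (A : ℝ) ^ (2 * k + 1)) := by
    calc (z : ℝ) ^ (k * (2 * k + 1)) * (z : ℝ) ^ k = ((z : ℝ) ^ (2 * k)) ^ (k + 1) := by ring
      _ ≤ (K ^ (2 * k) * (r : ℝ) ^ (2 * k + 1)) ^ (k + 1) := by gcongr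
      _ = K ^ (2 * k * (k + 1)) * ((r : ℝ) ^ (k + 1)) ^ (2 * k + 1) := by ring
      _ ≤ K ^ (2 * k * (k + 1)) * (A * (z : ℝ) ^ k) ^ (2 * k + 1) := by gcongr
      _ = _ := by ring
  have h5 : (z : ℝ) ^ k ≤ K ^ (2 * k * (k + 1)) * (A : ℝ) ^ (2 * k + 1) :=
    le_of_mul_le_mul_left h4 (by positivity)
  have h6 : (z : ℝ) ≤ z ^ k := le_self_pow₀ hz1 hk.ne'
  exact_mod_cast (h6.trans h5).trans (Nat.le_ceil _)

lemma Nat.radical_le_of_dvd_pow {a r k : ℕ} (ha : a ≠ 0) (hr : 0 < r) (h : a ∣ r ^ k) :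
    radical a ≤ r :=
  Nat.le_of_dvd hr ((UniqueFactorizationMonoid.exists_dvd_pow_iff_radical_dvd ha).1 ⟨k, h⟩)

/-! ### The equation `p ^ c + q = q ^ b + p` -/

lemma exponent_lt_of_pow_add_eq {p q b c : ℕ} (hp : 0 < p) (hpq : p < q) (hc : 2 ≤ c)
    (h : p ^ c + q = q ^ b + p) : b < c := by
  by_contra! hcb
  have h1 : q ^ c ≤ q ^ b := Nat.pow_le_pow_right (by omega) hcb
  obtain ⟨c, rfl⟩ : ∃ c', c = c' + 2 := ⟨c - 2, by omega⟩
  have h2 : p ^ (c + 1) ≤ q ^ (c + 1) := Nat.pow_le_pow_left hpq.le _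
  have h3 : q ≤ q ^ (c + 1) := Nat.le_self_pow (by omega) q
  have h4 : p ^ (c + 2) = p ^ (c + 1) * p := pow_succ _ _
  have h5 : q ^ (c + 2) = q ^ (c + 1) * q := pow_succ _ _
  obtain ⟨d, rfl⟩ := Nat.exists_eq_add_of_lt hpq
  nlinarith [Nat.mul_le_mul_right p h2, Nat.mul_le_mul_right (d + 1) h3]

/-- Write `q = p * m + 1`; the equation becomes `p * m ^ 2 + m + 1 = p ^ (c - 1)`, so
`m = p * k - 1`, and then `(p * k - 1) ^ 2 + k = p ^ (c - 2)`, where the left side is too large for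
`c = 3` and differs from `p ^ 2` for `c = 4`. -/
lemma no_solution_of_exponent_three_or_four {p q c : ℕ} (hp : 3 ≤ p) (hpp : p.Prime)
    (hq : q.Prime) (hpq : p < q) (hc : c = 3 ∨ c = 4) : p ^ c + q ≠ q ^ 2 + p := by
  intro h
  have hdvd : p ∣ q * (q - 1) := by
    have h1 : q * (q - 1) + p = p ^ c := by
      obtain ⟨t, rfl⟩ : ∃ t, q = t + 1 := ⟨q - 1, by omega⟩
      rw [Nat.add_sub_cancel]
      nlinarith
    exact (Nat.dvd_add_left dvd_rfl).1 (h1 ▸ dvd_pow_self p (by omega))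
  have hm : p ∣ q - 1 := (hpp.dvd_mul.1 hdvd).resolve_left fun h' =>
    hpq.ne ((Nat.prime_dvd_prime_iff_eq hpp hq).1 h')
  obtain ⟨m, hm⟩ := hm
  obtain rfl : q = p * m + 1 := by omega
  have h2 : p * m ^ 2 + m + 1 = p ^ (c - 1) := by
    obtain ⟨e, rfl⟩ : ∃ e, c = e + 1 := ⟨c - 1, by omega⟩
    rw [Nat.add_sub_cancel]
    refine Nat.eq_of_mul_eq_mul_left (by omega : 0 < p) ?_
    rw [pow_succ] at h
    nlinarith
  have h3 : p ∣ m + 1 := by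
    have : p ∣ p * m ^ 2 + (m + 1) := by
      rw [← add_assoc, h2]
      exact dvd_pow_self p (by omega)
    exact (Nat.dvd_add_right (dvd_mul_right _ _)).1 this
  obtain ⟨k, hk⟩ := h3
  have hk1 : 1 ≤ k := by
    by_contra! h0
    obtain rfl : k = 0 := by omega
    omega
  have hmz : (m : ℤ) = p * k - 1 := by
    have : (m : ℤ) + 1 = p * k := by exact_mod_cast hk
    linarith
  have hpz : (3 : ℤ) ≤ p := by exact_mod_cast hp
  have hkz : (1 : ℤ) ≤ k := by exact_mod_cast hk1
  have h2z : (p : ℤ) * m ^ 2 + m + 1 = p ^ (c - 1) := by exact_mod_cast h2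
  rw [hmz] at h2z
  rcases hc with rfl | rfl
  · have h4 : ((p : ℤ) * k - 1) ^ 2 + k = p := by
      refine mul_left_cancel₀ (by omega : (p : ℤ) ≠ 0) ?_
      norm_num at h2z
      linarith
    nlinarith [mul_le_mul hpz hkz (by norm_num) (by linarith)]
  · have h4 : ((p : ℤ) * k - 1) ^ 2 + k = p ^ 2 := by
      refine mul_left_cancel₀ (by omega : (p : ℤ) ≠ 0) ?_
      norm_num at h2z
      linarith
    rcases hkz.eq_or_lt with h5 | h5
    · rw [← h5] at h4
      nlinarith
    · have h6 : (p : ℤ) * 2 ≤ p * k := by nlinarith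
      nlinarith

/-- The abc conjecture applied to `p ^ c + (q - p) = q ^ b`, whose radical `r` satisfies
`r ^ 12 ≤ (q ^ b) ^ 11`. -/
lemma exists_bound_of_three_le (habc : AbcConjecture) :
    ∃ B : ℕ, ∀ p q b c : ℕ, p.Prime → q.Prime → p < q → 3 ≤ b → b < c →
      p ^ c + q = q ^ b + p → q ^ b ≤ B := by
  obtain ⟨B, hB⟩ := habc.exists_bound 11 1 (by norm_num)
  refine ⟨B, fun p q b c hp hq hpq hb hbc h => ?_⟩
  have hq0 := hq.pos
  have hp0 := hp.pos
  refine hB (p ^ c) (q - p) (q ^ b) (p * (q - p) * q) (by positivity) (by omega) ?_ (by omega) ?_ ?_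
  · refine Nat.Coprime.pow_left _ ((Nat.coprime_sub_self_right hpq.le).2 ?_)
    exact (Nat.coprime_primes hp hq).2 hpq.ne
  · have hd : 0 < q - p := by omega
    refine Nat.radical_le_of_dvd_pow (k := b + c) (by positivity) (by positivity) ?_
    rw [mul_pow, mul_pow]
    exact mul_dvd_mul (mul_dvd_mul (pow_dvd_pow _ (by omega)) (dvd_pow_self _ (by omega)))
      (pow_dvd_pow _ (by omega))
  · have h1 : p ^ 4 ≤ q ^ b := (Nat.pow_le_pow_right hp0 (by omega)).trans (by omega : p ^ c ≤ q ^ b)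
    have h2 : q ^ 3 ≤ q ^ b := Nat.pow_le_pow_right hq0 hb
    calc (p * (q - p) * q) ^ (11 + 1) ≤ (p * q * q) ^ (11 + 1) := by gcongr; omega
      _ = (p ^ 4) ^ 3 * (q ^ 3) ^ 8 := by ring
      _ ≤ (q ^ b) ^ 3 * (q ^ b) ^ 8 := by gcongr
      _ = 1 * (q ^ b) ^ 11 := by ring

/-- The abc conjecture applied to `(2 * q - 1) ^ 2 + (4 * p - 1) = 4 * p ^ c`, whose radical `r`
satisfies `r ^ 10 ≤ 16 ^ 10 * (4 * p ^ c) ^ 9`. -/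
lemma exists_bound_of_exponent_two (habc : AbcConjecture) :
    ∃ B : ℕ, ∀ p q c : ℕ, p.Prime → q.Prime → 5 ≤ c →
      p ^ c + q = q ^ 2 + p → p ^ c ≤ B := by
  obtain ⟨B, hB⟩ := habc.exists_bound 9 (16 ^ 10) (by norm_num)
  refine ⟨B, fun p q c hp hq hc h => ?_⟩
  have hq0 := hq.two_le
  have hp0 := hp.two_le
  have hsum : (2 * q - 1) ^ 2 + (4 * p - 1) = 4 * p ^ c := by
    zify [(by omega : 1 ≤ 2 * q), (by omega : 1 ≤ 4 * p)]
    have : (p : ℤ) ^ c + q = q ^ 2 + p := by exact_mod_cast h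
    linarith
  have key : 4 * p ^ c ≤ B := by
    refine hB ((2 * q - 1) ^ 2) (4 * p - 1) (4 * p ^ c) ((2 * q - 1) * (4 * p - 1) * (2 * p))
      (pow_pos (by omega) _) (by omega) ?_ hsum ?_ ?_
    · -- Modulo `4 * p - 1`, the square is `4 * p ^ c`, a divisor of a power of `4 * p`.
      have h1 : Nat.Coprime (4 * p) (4 * p - 1) :=
        (Nat.coprime_self_sub_right (by omega)).2 (Nat.coprime_one_right _)
      refine Nat.coprime_add_self_left.1 (hsum ▸ Nat.Coprime.coprime_dvd_left ?_ (h1.pow_left c))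
      rw [mul_pow]
      exact mul_dvd_mul_right (dvd_pow_self 4 (by omega)) _
    · have hx : 0 < 2 * q - 1 := by omega
      have hy : 0 < 4 * p - 1 := by omega
      refine Nat.radical_le_of_dvd_pow (k := c + 2) (by positivity) (by positivity) ?_
      rw [mul_pow, mul_pow, mul_pow]
      refine mul_dvd_mul (mul_dvd_mul (pow_dvd_pow _ (by omega)) (dvd_pow_self _ (by omega)))
        (mul_dvd_mul ?_ (pow_dvd_pow _ (by omega)))
      exact pow_dvd_pow 2 (by omega : 2 ≤ c + 2)
    · have h1 : p ^ 5 ≤ p ^ c := Nat.pow_le_pow_right (by omega) hc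
      have h2 : q ^ 2 ≤ 4 * p ^ c := by nlinarith
      calc ((2 * q - 1) * (4 * p - 1) * (2 * p)) ^ (9 + 1)
          ≤ ((2 * q) * (4 * p) * (2 * p)) ^ (9 + 1) := by gcongr <;> omega
        _ = 16 ^ 10 * ((p ^ 5) ^ 4 * (q ^ 2) ^ 5) := by ring
        _ ≤ 16 ^ 10 * ((4 * p ^ c) ^ 4 * (4 * p ^ c) ^ 5) := by gcongr; omega
        _ = _ := by ring
  omega

/-- Under abc, the numbers `n = q ^ b + p = p ^ c + q` with `b ≥ 2` are bounded. -/
lemma exists_bound_of_pow_add_eq (habc : AbcConjecture) :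
    ∃ B : ℕ, ∀ p q b c : ℕ, p.Prime → 3 ≤ p → q.Prime → p < q → 2 ≤ b → 2 ≤ c →
      p ^ c + q = q ^ b + p → q ^ b + p ≤ B := by
  obtain ⟨B₁, h₁⟩ := exists_bound_of_three_le habc
  obtain ⟨B₂, h₂⟩ := exists_bound_of_exponent_two habc
  refine ⟨2 * (B₁ + B₂), fun p q b c hp hp3 hq hpq hb hc h => ?_⟩
  have hbc := exponent_lt_of_pow_add_eq hp.pos hpq hc h
  have hqb : q ≤ q ^ b := Nat.le_self_pow (by omega) q
  rcases hb.eq_or_lt with rfl | hb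
  · have hc5 : 5 ≤ c := by
      by_contra! hc5
      exact no_solution_of_exponent_three_or_four hp3 hp hq hpq (by omega) h
    have := h₂ p q c hp hq hc5 h
    nlinarith
  · have := h₁ p q b c hp hq hpq hb hbc h
    omega

/-! ### Twin exceptional components -/

namespace Goldbach

/-- Every prime factor `s` of `n - t` is at most `n - 2`, hence a vertex with an arc to `t`. -/
lemma mem_of_prime_dvd_sub {n : ℕ} {U : Set ℕ} (hU : IsAutonomousSet n U) {s t : ℕ}
    (ht : t ∈ U) (hs : s.Prime) (hst : s ∣ n - t) : s ∈ U := by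
  obtain ⟨-, hsub, hin⟩ := hU
  by_contra hsU
  have htv := hsub ht
  have htv' : t.Prime ∧ 2 ≤ t ∧ t + 2 ≤ n := htv
  have hle := Nat.le_of_dvd (by omega) hst
  have hsv : s ∈ (gfg n).verts := ⟨hs, hs.two_le, by omega⟩
  exact hin s ⟨hsv, hsU⟩ t ht ⟨hsv, htv, hst⟩

/-- In a minimal autonomous set `{p, q}` there is an arc from `q` to `p`, as otherwise `{p}` would
be autonomous. -/
lemma dvd_sub_of_minimal_pair {n p q : ℕ} (hpq : p ≠ q)
    (hU : Minimal (IsAutonomousSet n) {p, q}) : q ∣ n - p := by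
  by_contra hd
  have hp : p ∈ (gfg n).verts := hU.1.2.1 (by simp)
  have h1 : IsAutonomousSet n {p} := by
    refine ⟨by simp, by simpa using hp, ?_⟩
    rintro s ⟨hs, hsp⟩ t rfl ⟨hsv, -, hst⟩
    have := mem_of_prime_dvd_sub hU.1 (t := t) (by simp) hsv.1 hst
    rcases this with h | h
    · exact hsp h
    · exact hd (h ▸ hst)
  have : q ∈ ({p} : Set ℕ) := hU.2 h1 (by simp) (by simp)
  exact hpq this.symm

/-- In a minimal autonomous set `{p, q}`, the prime `p` does not divide `n - p`: it would divide
`n` and, since it divides `n - q`, also `q`. -/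
lemma exists_sub_eq_pow_of_minimal_pair {n p q : ℕ} (hpq : p ≠ q)
    (hU : Minimal (IsAutonomousSet n) {p, q}) : ∃ b, n - p = q ^ b := by
  have hp : p.Prime ∧ 2 ≤ p ∧ p + 2 ≤ n := hU.1.2.1 (show p ∈ ({p, q} : Set ℕ) by simp)
  have hq : q.Prime ∧ 2 ≤ q ∧ q + 2 ≤ n := hU.1.2.1 (show q ∈ ({p, q} : Set ℕ) by simp)
  have hpnq : p ∣ n - q := dvd_sub_of_minimal_pair hpq.symm (Set.pair_comm p q ▸ hU)
  have hpn : ¬ p ∣ n - p := by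
    intro h
    have h1 : p ∣ n := by
      have := dvd_add h (dvd_refl p)
      rwa [Nat.sub_add_cancel (by omega)] at this
    have h2 : p ∣ q := (Nat.dvd_sub_iff_right (by omega) h1).1 hpnq
    exact hpq ((Nat.prime_dvd_prime_iff_eq hp.1 hq.1).1 h2)
  refine ⟨_, Nat.eq_prime_pow_of_unique_prime_dvd (by omega) fun {d} hd hdn => ?_⟩
  rcases mem_of_prime_dvd_sub hU.1 (t := p) (by simp) hd hdn with rfl | h
  · exact absurd hdn hpn
  · exact h

lemma verts_induce {n : ℕ} {U : Set ℕ} (hU : Minimal (IsAutonomousSet n) U) :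
    ((gfg n).induce U).verts = U :=
  Set.inter_eq_right.2 hU.1.2.1

lemma exists_primes_of_isTwinEAC {n : ℕ} (hn : Even n) {H : WeightedDigraph ℕ}
    (h : IsTwinEAC n H) : ∃ p q b c : ℕ, p.Prime ∧ 3 ≤ p ∧ q.Prime ∧ p < q ∧ 2 ≤ b ∧ 2 ≤ c ∧
      p ^ c + q = n ∧ q ^ b + p = n := by
  obtain ⟨⟨hcomp, -, hgac⟩, hcard⟩ := h
  obtain ⟨U, hU, rfl⟩ := id hcomp
  rw [verts_induce hU, Set.ncard_eq_two] at hcard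
  obtain ⟨p, q, hpq, rfl⟩ := hcard
  wlog hlt : p < q generalizing p q
  · rw [Set.pair_comm] at hU hgac hcomp
    exact this q p hpq.symm hU hcomp hgac (by omega)
  have hpv : p ∈ (gfg n).verts := hU.1.2.1 (by simp)
  have hqv : q ∈ (gfg n).verts := hU.1.2.1 (by simp)
  obtain ⟨hp, -, hpn⟩ := id hpv
  obtain ⟨hq, -, hqn⟩ := id hqv
  have hsum : p + q ≠ n := fun hs => hgac ⟨hcomp, p, hpv, q, hqv, hs, verts_induce hU⟩
  obtain ⟨b, hb⟩ := exists_sub_eq_pow_of_minimal_pair hpq hU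
  obtain ⟨c, hc⟩ := exists_sub_eq_pow_of_minimal_pair hpq.symm (Set.pair_comm p q ▸ hU)
  -- Exponent `0` is excluded by `n - p ≥ 2`, exponent `1` by `p + q ≠ n`.
  have two_le : ∀ {r m e : ℕ}, m = r ^ e → 2 ≤ m → m ≠ r → 2 ≤ e := by
    intro r m e hm h2 hr
    by_contra! he
    interval_cases e <;> simp at hm <;> omega
  have hb2 := two_le hb (by omega) (by omega)
  have hc2 := two_le hc (by omega) (by omega)
  have hp2 : p ≠ 2 := by
    rintro rfl
    have hodd : Odd (q ^ b) := (hq.odd_of_ne_two (by omega)).pow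
    rw [← hb] at hodd
    exact (Nat.not_even_iff_odd.2 hodd) ((Nat.even_sub (by omega)).2 (by simp [hn]))
  have := hp.two_le
  exact ⟨p, q, b, c, hp, by omega, hq, hlt, hb2, hc2, by omega, by omega⟩

lemma finite_setOf_le_isAutonomousComponent (B : ℕ) :
    {x : ℕ × WeightedDigraph ℕ | x.1 ≤ B ∧ IsAutonomousComponent x.1 x.2}.Finite := by
  refine (((Set.finite_Iic B).prod (Set.finite_Iic B).finite_subsets).image
    fun y : ℕ × Set ℕ => (y.1, (gfg y.1).induce y.2)).subset ?_
  rintro ⟨n, H⟩ ⟨hn, U, hU, hH⟩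
  refine ⟨(n, U), ⟨hn, fun u hu => ?_⟩, Prod.ext rfl hH.symm⟩
  have hn' : n ≤ B := hn
  have : u.Prime ∧ 2 ≤ u ∧ u + 2 ≤ n := hU.1.2.1 hu
  exact Set.mem_Iic.2 (by omega)

end Goldbach

theorem mainTheorem7 (habc : AbcConjecture) :
    {x : ℕ × WeightedDigraph ℕ |
      4 ≤ x.1 ∧ Even x.1 ∧ Goldbach.IsTwinEAC x.1 x.2}.Finite := by
  obtain ⟨B, hB⟩ := exists_bound_of_pow_add_eq habc
  refine (Goldbach.finite_setOf_le_isAutonomousComponent B).subset ?_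
  rintro ⟨n, H⟩ ⟨-, hn, hH⟩
  obtain ⟨p, q, b, c, hp, hp3, hq, hpq, hb, hc, h1, h2⟩ :=
    Goldbach.exists_primes_of_isTwinEAC hn hH
  exact ⟨h2 ▸ hB p q b c hp hp3 hq hpq hb hc (h1.trans h2.symm), hH.1.1⟩
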